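/- Let $T\ge 1$, let $(\Omega,\mathcal F,P,(\mathcal F_t)_{t=0}^T)$ be a filtered probability space with $\mathcal F_0$ $P$-trivial, and let $I$ be a finite set of agents. For each agent $i\in I$ and $t=0,\dots,T-1$ let $E^i_t\ge 0$ be an $\mathcal F_t$-measurable random variable (business-as-usual emission), and let $C^i_t:[0,\infty)\times\Omega\to\mathbb R$ be $\mathcal B([0,\infty))\otimes\mathcal F_t$-measurable such that for each $\omega$ the function $x\mapsto C^i_t(x)(\omega)$ is strictly convex and continuous with $C^i_t(0)(\omega)=0$ (abatement cost). For each $i$ let $\gamma^i$ be an $\mathcal F_T$-measurable random variable (allowance allocation) and let $U^i:\mathbb R\to\mathbb R$ be continuous, strictly increasing and concave (utility function). Assume that $P(\sum_{i\in I}\gamma^i=X)=0$ for each $\mathcal F_{T-1}$-measurable real random variable $X$, and let $\pi\in(0,\infty)$ (penalty). Let $c^i_t(a)(\omega)$ denote the unique minimiser of $x\mapsto C^i_t(x)(\omega)-ax$ on $[0,E^i_t(\omega)]$. Let $\mathcal U^i$ be the set of pairs $(\vartheta,\xi)$ of adapted real-valued processes $\vartheta=(\vartheta_t)_{t=0}^T$,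 $\xi=(\xi_t)_{t=0}^{T-1}$ with $0\le\xi_t\le E^i_t$ almost surely for $t=0,\dots,T-1$. For an adapted price process $A=(A_t)_{t=0}^T$ and $(\vartheta,\xi)\in\mathcal U^i$ put $$L^{A,i}(\vartheta,\xi)=-\sum_{t=0}^{T-1}\bigl(\vartheta_tA_t+C^i_t(\xi_t)\bigr)-\vartheta_TA_T-\pi\Bigl(\sum_{t=0}^{T-1}(E^i_t-\xi_t-\vartheta_t)-\gamma^i-\vartheta_T\Bigr)^+,$$ and let $u^i(X)=\mathbb E(U^i(X))$, which is said to exist if this expectation is well defined in $(-\infty,+\infty]$. An adapted process $A^*$ is an equilibrium allowance price process with equilibrium abatement policies $(\xi^{i*})_{i\in I}$ if there are $\vartheta^{i*}$ with $(\vartheta^{i*},\xi^{i*})\in\mathcal U^i$ such that $u^i(L^{A^*,i}(\vartheta^{i*},\xi^{i*}))$ is finite for each $i$, $\sum_{i\in I}\vartheta^{i*}_t=0$ almost surely for $t=0,\dots,T$, and, for each $i$, $u^i(L^{A^*,i}(\vartheta^{i*},\xi^{i*}))\ge u^i(L^{A^*,i}(\vartheta,\xi))$ for all $(\vartheta,\xi)\in\mathcal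 U^i$ for which the right-hand side exists. Suppose that $A^*=(A^*_t)_{t=0}^T$ is an equilibrium allowance price process with equilibrium abatement policies $(\xi^{i*}_t)_{t=0}^{T-1}$, $i\in I$. Then: (a) there is a probability measure $Q$ equivalent to $P$ such that $(A^*_t)_{t=0}^T$ is a $Q$-martingale with respect to $(\mathcal F_t)_{t=0}^T$; (b) for each $i\in I$ and $t=0,\dots,T-1$, $\xi^{i*}_t=c^i_t(A^*_t)$ almost surely; (c) almost surely, $A^*_T=\pi\,1_{\{\sum_{i\in I}(\sum_{t=0}^{T-1}(E^i_t-\xi^{i*}_t)-\gamma^i)\ge 0\}}$. -/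

import Mathlib

open MeasureTheory Set
open scoped ENNReal

/-- A stand-alone emission allowance market over the periods `0, …, T` (with `T ≥ 1`) with agents
`I`, on a filtered probability space `(Ω, P, (ℱ t) t = 0, …, T)`. Processes `(X_t)`, `t = 0, …, T`,
are indexed by `Fin (T + 1)` and processes `(X_t)`, `t = 0, …, T - 1`, by `Fin T`; the time
`t : Fin T` is the time `t.castSucc` of the filtration. -/
structure EmissionMarket {Ω : Type*} [mΩ : MeasurableSpace Ω] (I : Type*) [Fintype I] (T : ℕ)
    (P : Measure Ω) (ℱ : Filtration (Fin (T + 1)) mΩ) where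
  /-- There is at least one period. -/
  horizon_pos : 0 < T
  /-- The initial information is deterministic. -/
  initial_trivial : ∀ s : Set Ω, MeasurableSet[ℱ 0] s → P s = 0 ∨ P s = 1
  /-- Business-as-usual emission `E i t` of agent `i` in `[t, t + 1]`. -/
  E : I → Fin T → Ω → ℝ
  measurable_E : ∀ i t, Measurable[ℱ t.castSucc] (E i t)
  E_nonneg : ∀ i t ω, 0 ≤ E i t ω
  /-- Abatement costs: `C i t x ω` is the cost for agent `i` of reducing, at time `t`, the emission
  by `x ∈ [0, ∞)`; the values at negative `x` play no role. -/
  C : I → Fin T → ℝ → Ω → ℝ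
  measurable_C : ∀ i t,
    Measurable[(inferInstance : MeasurableSpace (Ici (0 : ℝ))).prod (ℱ t.castSucc)]
      (fun p : Ici (0 : ℝ) × Ω => C i t p.1 p.2)
  strictConvexOn_C : ∀ i t ω, StrictConvexOn ℝ (Ici (0 : ℝ)) (fun x => C i t x ω)
  continuousOn_C : ∀ i t ω, ContinuousOn (fun x => C i t x ω) (Ici (0 : ℝ))
  C_zero : ∀ i t ω, C i t 0 ω = 0
  /-- Penalty per unit of pollutant that is not covered by allowances. -/
  penalty : ℝ
  penalty_pos : 0 < penalty
  /-- Initial allowance allocation `γ i` (net of emissions that become known only at time `T`). -/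
  γ : I → Ω → ℝ
  measurable_γ : ∀ i, Measurable[ℱ (Fin.last T)] (γ i)
  /-- The total allocation has no point masses conditionally on the information at time `T - 1`:
  it coincides with probability zero with any random variable known at time `T - 1`. -/
  no_point_mass : ∀ X : Ω → ℝ, Measurable[ℱ ⟨T - 1, by omega⟩] X → P {ω | ∑ i, γ i ω = X ω} = 0
  /-- Utility function `U i` of agent `i`. -/
  U : I → ℝ → ℝ
  continuous_U : ∀ i, Continuous (U i)
  strictMono_U : ∀ i, StrictMono (U i)
  concaveOn_U : ∀ i, ConcaveOn ℝ univ (U i)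

namespace EmissionMarket

variable {Ω : Type*} [mΩ : MeasurableSpace Ω] {I : Type*} [Fintype I] {T : ℕ}
  {P : Measure Ω} {ℱ : Filtration (Fin (T + 1)) mΩ}

/-- The function `x ↦ C i t x ω - a x` has exactly one minimiser on `[0, E i t ω]`. -/
theorem existsUnique_minimiser (M : EmissionMarket I T P ℱ) (i : I) (t : Fin T) (a : ℝ) (ω : Ω) :
    ∃! x : ℝ, x ∈ Icc 0 (M.E i t ω) ∧
      IsMinOn (fun x => M.C i t x ω - a * x) (Icc 0 (M.E i t ω)) x := by
  have hsub : Icc 0 (M.E i t ω) ⊆ Ici (0 : ℝ) := fun x hx => hx.1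
  have hcont : ContinuousOn (fun x => M.C i t x ω - a * x) (Icc 0 (M.E i t ω)) :=
    ((M.continuousOn_C i t ω).mono hsub).sub (by fun_prop)
  have hlin : ConvexOn ℝ (Icc 0 (M.E i t ω)) (fun x : ℝ => -(a * x)) :=
    ⟨convex_Icc _ _, fun x _ y _ p q _ _ _ => le_of_eq (by simp only [smul_eq_mul]; ring)⟩
  have hconv : StrictConvexOn ℝ (Icc 0 (M.E i t ω)) (fun x => M.C i t x ω - a * x) := by
    simpa [sub_eq_add_neg, Pi.add_def] using
      ((M.strictConvexOn_C i t ω).subset hsub (convex_Icc _ _)).add_convexOn hlin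
  obtain ⟨x, hx, hmin⟩ :=
    isCompact_Icc.exists_isMinOn (nonempty_Icc.2 (M.E_nonneg i t ω)) hcont
  exact ⟨x, ⟨hx, hmin⟩, fun y hy => hconv.eq_of_isMinOn hy.2 hmin hy.1 hx⟩

/-- The abatement volume `c i t (a) = argmin {C i t (x) - a x : x ∈ [0, E i t]}`. -/
noncomputable def abatementVolume (M : EmissionMarket I T P ℱ) (i : I) (t : Fin T) (a : ℝ)
    (ω : Ω) : ℝ :=
  Classical.choose (M.existsUnique_minimiser i t a ω).exists

theorem abatementVolume_spec (M : EmissionMarket I T P ℱ) (i : I) (t : Fin T) (a : ℝ) (ω : Ω) :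
    M.abatementVolume i t a ω ∈ Icc 0 (M.E i t ω) ∧
      IsMinOn (fun x => M.C i t x ω - a * x) (Icc 0 (M.E i t ω)) (M.abatementVolume i t a ω) :=
  Classical.choose_spec (M.existsUnique_minimiser i t a ω).exists

/-- The set of feasible policies of agent `i`: adapted trading strategies `ϑ` and adapted abatement
strategies `ξ` with `0 ≤ ξ t ≤ E i t` almost surely. -/
def Feasible (M : EmissionMarket I T P ℱ) (i : I) (ϑ : Fin (T + 1) → Ω → ℝ)
    (ξ : Fin T → Ω → ℝ) : Prop :=
  (∀ t, Measurable[ℱ t] (ϑ t)) ∧ (∀ t, Measurable[ℱ t.castSucc] (ξ t)) ∧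
    ∀ t, ∀ᵐ ω ∂P, 0 ≤ ξ t ω ∧ ξ t ω ≤ M.E i t ω

/-- The revenue of agent `i` from the policy `(ϑ, ξ)` under the allowance prices `A`: minus the
costs of trading and abatement, minus the penalty payment at time `T`. -/
noncomputable def revenue (M : EmissionMarket I T P ℱ) (A : Fin (T + 1) → Ω → ℝ) (i : I)
    (ϑ : Fin (T + 1) → Ω → ℝ) (ξ : Fin T → Ω → ℝ) (ω : Ω) : ℝ :=
  -(∑ t : Fin T, (ϑ t.castSucc ω * A t.castSucc ω + M.C i t (ξ t ω) ω))
    - ϑ (Fin.last T) ω * A (Fin.last T) ω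
    - M.penalty * max (∑ t : Fin T, (M.E i t ω - ξ t ω - ϑ t.castSucc ω) - M.γ i ω
        - ϑ (Fin.last T) ω) 0

/-- The expected utility of agent `i` exists, as a number in `(-∞, ∞]`. -/
def UtilityExists (M : EmissionMarket I T P ℱ) (i : I) (X : Ω → ℝ) : Prop :=
  ∫⁻ ω, ENNReal.ofReal (-(M.U i (X ω))) ∂P ≠ ∞

/-- The expected utility `E (U i (X))`, with values in `(-∞, ∞]` whenever it exists. -/
noncomputable def utility (M : EmissionMarket I T P ℱ) (i : I) (X : Ω → ℝ) : EReal :=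
  ((∫⁻ ω, ENNReal.ofReal (M.U i (X ω)) ∂P : ℝ≥0∞) : EReal)
    - ((∫⁻ ω, ENNReal.ofReal (-(M.U i (X ω))) ∂P : ℝ≥0∞) : EReal)

/-- The adapted price process `A` together with the policies `(ϑ i, ξ i)`, `i ∈ I`, is a market
equilibrium: the policies are feasible with finite expected utility, position changes are in zero
net supply, and no agent can improve the expected utility by another feasible policy. -/
structure IsEquilibrium (M : EmissionMarket I T P ℱ) (A : Fin (T + 1) → Ω → ℝ)
    (ϑ : I → Fin (T + 1) → Ω → ℝ) (ξ : I → Fin T → Ω → ℝ) : Prop where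
  adapted : ∀ t, Measurable[ℱ t] (A t)
  feasible : ∀ i, M.Feasible i (ϑ i) (ξ i)
  utility_exists : ∀ i, M.UtilityExists i (M.revenue A i (ϑ i) (ξ i))
  utility_ne_top : ∀ i, M.utility i (M.revenue A i (ϑ i) (ξ i)) ≠ ⊤
  zero_net_supply : ∀ t, ∀ᵐ ω ∂P, ∑ i, ϑ i t ω = 0
  optimal : ∀ i ϑ' ξ', M.Feasible i ϑ' ξ' → M.UtilityExists i (M.revenue A i ϑ' ξ') →
    M.utility i (M.revenue A i ϑ' ξ') ≤ M.utility i (M.revenue A i (ϑ i) (ξ i))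

/-- `A` is an equilibrium allowance price process and `ξ` are corresponding equilibrium abatement
policies. -/
def IsEquilibriumPrice (M : EmissionMarket I T P ℱ) (A : Fin (T + 1) → Ω → ℝ)
    (ξ : I → Fin T → Ω → ℝ) : Prop :=
  ∃ ϑ : I → Fin (T + 1) → Ω → ℝ, M.IsEquilibrium A ϑ ξ

end EmissionMarket

/-! Everything follows from perturbing one agent's equilibrium policy. If a feasible policy earns at
least the equilibrium revenue almost surely, then its utility exists, and optimality, finite utility
and strict monotonicity force equality almost surely (`revenue_ae_eq`). Three perturbations are
used.

Buying `H` at `t` and reselling at `t + 1` adds `H` times the price increment to the revenue, so the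
price admits no one-period arbitrage (`no_arbitrage`). A martingale measure is then built by
backward induction from one-period densities (`exists_density_condExp_eq_zero`).

Changing the abatement at `t` and trading the difference at the same date leaves the penalty
unchanged, so the equilibrium abatement minimises cost minus price times volume (`abatement_le`,
`abatement_eq`).

Trading at `T` alone (`terminal_trade`) puts the price in `[0, π]`; a positive price excludes agents
with a surplus, and a price below `π` excludes agents with a shortage. Zero net supply and the
absence of point masses then determine the price (`terminal_price`). -/

section EquivalentMartingaleMeasure

variable {Ω : Type*} {mΩ : MeasurableSpace Ω}

/-! ### One-period densities and changes of measure -/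

theorem condExp_eq_zero_of_forall_setIntegral_eq_zero {μ : Measure Ω} [IsFiniteMeasure μ]
    {m : MeasurableSpace Ω} (hm : m ≤ mΩ) {D : Ω → ℝ} (hD : Integrable D μ)
    (h : ∀ S, MeasurableSet[m] S → ∫ ω in S, D ω ∂μ = 0) : μ[D | m] =ᵐ[μ] 0 :=
  (ae_eq_condExp_of_forall_setIntegral_eq hm hD
    (fun _ _ _ => (integrable_zero Ω ℝ μ).integrableOn)
    (fun S hS _ => by simp [h S hS]) aestronglyMeasurable_zero).symm

/-- Multiplication with a bounded density known at the initial time preserves the martingale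
property of a martingale increment. -/
theorem setIntegral_mul_eq_zero_of_measurable {μ : Measure Ω} [IsFiniteMeasure μ]
    {m : MeasurableSpace Ω} (hm : m ≤ mΩ) {D Z : Ω → ℝ} (hD : Integrable D μ)
    (hZ : Measurable[m] Z) (hZ1 : ∀ ω, ‖Z ω‖ ≤ 1)
    (h : ∀ S, MeasurableSet[m] S → ∫ ω in S, D ω ∂μ = 0) {S : Set Ω} (hS : MeasurableSet[m] S) :
    ∫ ω in S, Z ω * D ω ∂μ = 0 := by
  have h1 : μ[Z * D | m] =ᵐ[μ] Z * μ[D | m] :=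
    condExp_stronglyMeasurable_mul_of_bound hm hZ.stronglyMeasurable hD 1 (ae_of_all _ hZ1)
  have h2 := condExp_eq_zero_of_forall_setIntegral_eq_zero hm hD h
  have hint : Integrable (Z * D) μ :=
    hD.bdd_mul (hZ.mono hm le_rfl).aestronglyMeasurable (ae_of_all _ hZ1)
  change ∫ ω in S, (Z * D) ω ∂μ = 0
  rw [← setIntegral_condExp hm hint hS]
  refine integral_eq_zero_of_ae (ae_restrict_of_ae ?_)
  filter_upwards [h1, h2] with ω h1 h2
  simp [h1, h2]

/-- If no bet on the sign of `D` made with the information `m` is an arbitrage, then `D` has mean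
zero given `m` after multiplication with some positive density that is bounded by one. -/
theorem exists_density_condExp_eq_zero {μ : Measure Ω} [IsFiniteMeasure μ]
    {m m' : MeasurableSpace Ω} (hmm' : m ≤ m') (hm' : m' ≤ mΩ) {D : Ω → ℝ} (hD : Integrable D μ)
    (hDm : Measurable[m'] D)
    (hNA : ∀ H : Ω → ℝ, Measurable[m] H → (∀ᵐ ω ∂μ, 0 ≤ H ω * D ω) →
      ∀ᵐ ω ∂μ, H ω * D ω = 0) :
    ∃ Z : Ω → ℝ, Measurable[m'] Z ∧ (∀ ω, 0 < Z ω ∧ Z ω ≤ 1) ∧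
      ∀ S, MeasurableSet[m] S → ∫ ω in S, Z ω * D ω ∂μ = 0 := by
  classical
  have hm := hmm'.trans hm'
  have hp : Integrable (fun ω => max (D ω) 0) μ := hD.pos_part
  have hn : Integrable (fun ω => max (-D ω) 0) μ := hD.neg_part
  set a := μ[fun ω => max (D ω) 0 | m]
  set b := μ[fun ω => max (-D ω) 0 | m]
  have ha : Measurable[m] a := stronglyMeasurable_condExp.measurable
  have hb : Measurable[m] b := stronglyMeasurable_condExp.measurable
  -- On the `m`-measurable set where the conditional expectation is nonpositive, `f` has nonpositive
  -- integral, so a nonnegative `f` vanishes there.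
  have key : ∀ f : Ω → ℝ, Integrable f μ → (∀ ω, 0 ≤ f ω) →
      ∀ᵐ ω ∂μ, (μ[f | m]) ω ≤ 0 → f ω = 0 := by
    intro f hf hf0
    have hS : MeasurableSet[m] {ω | (μ[f | m]) ω ≤ 0} :=
      measurableSet_le stronglyMeasurable_condExp.measurable measurable_const
    have h1 : ∫ ω in {ω | (μ[f | m]) ω ≤ 0}, f ω ∂μ = 0 := by
      refine le_antisymm ?_ (integral_nonneg hf0)
      rw [← setIntegral_condExp hm hf hS]
      exact setIntegral_nonpos (hm _ hS) fun ω hω => hω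
    rw [setIntegral_eq_zero_iff_of_nonneg_ae (ae_of_all _ hf0) hf.integrableOn] at h1
    exact (ae_restrict_iff' (hm _ hS)).1 h1
  -- Where `a ≤ 0` there are almost surely no gains, so betting `-1` there is riskless; likewise
  -- `+1` where `b ≤ 0`. No arbitrage makes `D` vanish on both sets.
  have hsup : ∀ᵐ ω ∂μ, ¬(0 < a ω ∧ 0 < b ω) → D ω = 0 := by
    have h1 : ∀ᵐ ω ∂μ, {ω | a ω ≤ 0}.indicator (fun _ => (-1 : ℝ)) ω * D ω = 0 := by
      refine hNA _ (measurable_const.indicator (measurableSet_le ha measurable_const)) ?_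
      filter_upwards [key _ hp fun ω => le_max_right _ _] with ω hω
      by_cases h : a ω ≤ 0
      · have := hω h
        have := le_max_left (D ω) 0
        simp only [indicator_of_mem (show ω ∈ {ω | a ω ≤ 0} from h)]
        linarith
      · simp [h]
    have h2 : ∀ᵐ ω ∂μ, {ω | b ω ≤ 0}.indicator (fun _ => (1 : ℝ)) ω * D ω = 0 := by
      refine hNA _ (measurable_const.indicator (measurableSet_le hb measurable_const)) ?_
      filter_upwards [key _ hn fun ω => le_max_right _ _] with ω hω
      by_cases h : b ω ≤ 0
      · have := hω h
        have := le_max_left (-D ω) 0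
        simp only [indicator_of_mem (show ω ∈ {ω | b ω ≤ 0} from h)]
        linarith
      · simp [h]
    filter_upwards [h1, h2] with ω h1 h2 h
    by_contra hD0
    refine h ⟨?_, ?_⟩
    · by_contra! h0
      simp [h0, hD0] at h1
    · by_contra! h0
      simp [h0, hD0] at h2
  set g : Set Ω := {ω | 0 < a ω} ∩ {ω | 0 < b ω}
  have hg : MeasurableSet[m] g :=
    (measurableSet_lt measurable_const ha).inter (measurableSet_lt measurable_const hb)
  -- Gains get weight `β ∝ b` and losses weight `α ∝ a`, so the conditional mean of the weighted `D`
  -- is `β a - α b = 0`. The common denominator only brings the weights into `(0, 1]`.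
  set α : Ω → ℝ := g.indicator fun ω => a ω / (1 + a ω + b ω)
  set β : Ω → ℝ := g.indicator fun ω => b ω / (1 + a ω + b ω)
  have hα : Measurable[m] α := (ha.div ((measurable_const.add ha).add hb)).indicator hg
  have hβ : Measurable[m] β := (hb.div ((measurable_const.add ha).add hb)).indicator hg
  have hg1 : ∀ ω ∈ g, (0 < α ω ∧ α ω ≤ 1) ∧ (0 < β ω ∧ β ω ≤ 1) := by
    intro ω hω
    have h1 : 0 < a ω := hω.1
    have h2 : 0 < b ω := hω.2
    simp only [α, β, indicator_of_mem hω]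
    refine ⟨⟨by positivity, ?_⟩, ⟨by positivity, ?_⟩⟩ <;> rw [div_le_one (by positivity)] <;>
      linarith
  have hα1 : ∀ ω, ‖α ω‖ ≤ 1 := fun ω => by
    by_cases hω : ω ∈ g
    · rw [Real.norm_of_nonneg (hg1 ω hω).1.1.le]
      exact (hg1 ω hω).1.2
    · simp [α, hω]
  have hβ1 : ∀ ω, ‖β ω‖ ≤ 1 := fun ω => by
    by_cases hω : ω ∈ g
    · rw [Real.norm_of_nonneg (hg1 ω hω).2.1.le]
      exact (hg1 ω hω).2.2
    · simp [β, hω]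
  set Z : Ω → ℝ := fun ω => if ω ∈ g ∧ 0 < D ω then β ω else if ω ∈ g ∧ D ω < 0 then α ω else 1
  have hZD : ∀ᵐ ω ∂μ, Z ω * D ω = β ω * max (D ω) 0 - α ω * max (-D ω) 0 := by
    filter_upwards [hsup] with ω hω
    by_cases hωg : ω ∈ g
    · rcases lt_trichotomy (D ω) 0 with h | h | h
      · simp [Z, hωg, h, h.not_gt, max_eq_right h.le, max_eq_left (neg_nonneg.2 h.le)]
      · simp [h]
      · simp [Z, hωg, h, max_eq_left h.le, max_eq_right (neg_nonpos.2 h.le)]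
    · simp [hω hωg]
  refine ⟨Z, ?_, fun ω => ?_, fun S hS => ?_⟩
  · have hgm := hmm' _ hg
    refine Measurable.ite (hgm.inter (measurableSet_lt measurable_const hDm))
      (hβ.mono hmm' le_rfl) (Measurable.ite (hgm.inter (measurableSet_lt hDm measurable_const))
      (hα.mono hmm' le_rfl) measurable_const)
  · simp only [Z]
    split_ifs with h1 h2
    · exact (hg1 ω h1.1).2
    · exact (hg1 ω h2.1).1
    · exact ⟨one_pos, le_rfl⟩
  · have hβp : Integrable (β * fun ω => max (D ω) 0) μ :=
      hp.bdd_mul (hβ.mono hm le_rfl).aestronglyMeasurable (ae_of_all _ hβ1)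
    have hαn : Integrable (α * fun ω => max (-D ω) 0) μ :=
      hn.bdd_mul (hα.mono hm le_rfl).aestronglyMeasurable (ae_of_all _ hα1)
    have e1 : μ[β * fun ω => max (D ω) 0 | m] =ᵐ[μ] β * a :=
      condExp_stronglyMeasurable_mul_of_bound hm hβ.stronglyMeasurable hp 1 (ae_of_all _ hβ1)
    have e2 : μ[α * fun ω => max (-D ω) 0 | m] =ᵐ[μ] α * b :=
      condExp_stronglyMeasurable_mul_of_bound hm hα.stronglyMeasurable hn 1 (ae_of_all _ hα1)
    calc ∫ ω in S, Z ω * D ω ∂μ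
        = ∫ ω in S, ((β * fun ω => max (D ω) 0) ω - (α * fun ω => max (-D ω) 0) ω) ∂μ :=
          integral_congr_ae (ae_restrict_of_ae hZD)
      _ = ∫ ω in S, (μ[β * fun ω => max (D ω) 0 | m]) ω ∂μ -
          ∫ ω in S, (μ[α * fun ω => max (-D ω) 0 | m]) ω ∂μ := by
          rw [integral_sub hβp.integrableOn hαn.integrableOn, setIntegral_condExp hm hβp hS,
            setIntegral_condExp hm hαn hS]
      _ = 0 := by
          rw [sub_eq_zero]
          refine integral_congr_ae (ae_restrict_of_ae ?_)
          filter_upwards [e1, e2] with ω h1 h2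
          rw [h1, h2]
          by_cases hω : ω ∈ g
          · simp only [α, β, Pi.mul_apply, indicator_of_mem hω]
            ring
          · simp [α, β, hω]

theorem integrable_withDensity_ofReal_of_bounded {μ : Measure Ω} {Z : Ω → ℝ} (hZ : Measurable Z)
    (hZ0 : ∀ ω, 0 < Z ω ∧ Z ω ≤ 1) {f : Ω → ℝ} (hf : Integrable f μ) :
    Integrable f (μ.withDensity fun ω => ENNReal.ofReal (Z ω)) := by
  rw [integrable_withDensity_iff_integrable_smul' hZ.ennreal_ofReal
    (ae_of_all _ fun _ => ENNReal.ofReal_lt_top)]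
  simp only [ENNReal.toReal_ofReal (hZ0 _).1.le, smul_eq_mul]
  refine hf.bdd_mul (c := 1) hZ.aestronglyMeasurable (ae_of_all _ fun ω => ?_)
  rw [Real.norm_of_nonneg (hZ0 ω).1.le]
  exact (hZ0 ω).2

theorem absolutelyContinuous_withDensity_ofReal {μ : Measure Ω} {Z : Ω → ℝ} (hZ : Measurable Z)
    (hZ0 : ∀ ω, 0 < Z ω) : μ ≪ μ.withDensity fun ω => ENNReal.ofReal (Z ω) :=
  withDensity_absolutelyContinuous' hZ.ennreal_ofReal.aemeasurable
    (ae_of_all _ fun ω => (ENNReal.ofReal_pos.2 (hZ0 ω)).ne')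

theorem isFiniteMeasure_withDensity_ofReal_of_le_one {μ : Measure Ω} [IsFiniteMeasure μ]
    {Z : Ω → ℝ} (hZ1 : ∀ ω, Z ω ≤ 1) :
    IsFiniteMeasure (μ.withDensity fun ω => ENNReal.ofReal (Z ω)) := by
  refine isFiniteMeasure_withDensity (ne_top_of_le_ne_top (measure_ne_top μ univ) ?_)
  rw [← lintegral_one]
  exact lintegral_mono fun ω => ENNReal.ofReal_le_one.2 (hZ1 ω)

/-! ### Backward construction of the martingale measure -/

/-- Here `k` counts the increments, from the last one backwards, already made centred. The density
that corrects an increment is known at its end, hence at the start of all later increments, which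
therefore stay centred. -/
theorem exists_finite_measure_increments {T : ℕ} {P : Measure Ω} [IsFiniteMeasure P]
    {ℱ : Filtration (Fin (T + 1)) mΩ} {A : Fin (T + 1) → Ω → ℝ}
    (hA : ∀ t, Measurable[ℱ t] (A t))
    (hNA : ∀ (t : Fin T) (H : Ω → ℝ), Measurable[ℱ t.castSucc] H →
      (∀ᵐ ω ∂P, 0 ≤ H ω * (A t.succ ω - A t.castSucc ω)) →
      ∀ᵐ ω ∂P, H ω * (A t.succ ω - A t.castSucc ω) = 0) (k : ℕ) :
    ∃ μ : Measure Ω, IsFiniteMeasure μ ∧ μ ≪ P ∧ P ≪ μ ∧ (∀ s, Integrable (A s) μ) ∧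
      ∀ t : Fin T, T ≤ t + k → ∀ S, MeasurableSet[ℱ t.castSucc] S →
        ∫ ω in S, (A t.succ ω - A t.castSucc ω) ∂μ = 0 := by
  induction k with
  | zero =>
    have hAm : ∀ s, Measurable (A s) := fun s => (hA s).mono (ℱ.le s) le_rfl
    -- This density makes every price integrable, since `|x| ≤ exp |x|` bounds `Z * |A s|` by `1`.
    set Z : Ω → ℝ := fun ω => Real.exp (-∑ s, |A s ω|)
    have hZ : Measurable Z := by fun_prop
    have hZ0 : ∀ ω, 0 < Z ω := fun ω => Real.exp_pos _
    have hZ1 : ∀ ω, Z ω ≤ 1 := fun ω => Real.exp_le_one_iff.2 (neg_nonpos.2 (by positivity))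
    refine ⟨P.withDensity fun ω => ENNReal.ofReal (Z ω),
      isFiniteMeasure_withDensity_ofReal_of_le_one hZ1, withDensity_absolutelyContinuous _ _,
      absolutelyContinuous_withDensity_ofReal hZ hZ0, fun s => ?_,
      fun t ht => absurd ht (by have := t.2; omega)⟩
    rw [integrable_withDensity_iff_integrable_smul' hZ.ennreal_ofReal
      (ae_of_all _ fun _ => ENNReal.ofReal_lt_top)]
    simp only [ENNReal.toReal_ofReal (hZ0 _).le, smul_eq_mul]
    refine Integrable.of_bound (hZ.mul (hAm s)).aestronglyMeasurable 1 (ae_of_all _ fun ω => ?_)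
    rw [norm_mul, Real.norm_of_nonneg (hZ0 ω).le, Real.norm_eq_abs]
    have h1 : |A s ω| ≤ ∑ s, |A s ω| :=
      Finset.single_le_sum (f := fun s => |A s ω|) (fun _ _ => abs_nonneg _) (Finset.mem_univ s)
    have h2 := Real.add_one_le_exp (∑ s, |A s ω|)
    calc Z ω * |A s ω| ≤ Z ω * Real.exp (∑ s, |A s ω|) :=
          mul_le_mul_of_nonneg_left (by linarith) (hZ0 ω).le
      _ = 1 := by rw [← Real.exp_add, neg_add_cancel, Real.exp_zero]
  | succ k ih =>
    obtain ⟨μ, hμ, hμP, hPμ, hint, hmart⟩ := ih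
    by_cases hk : k + 1 ≤ T
    swap
    · exact ⟨μ, hμ, hμP, hPμ, hint, fun t ht => hmart t (by omega)⟩
    set t₀ : Fin T := ⟨T - (k + 1), by omega⟩
    obtain ⟨Z, hZm, hZ0, hZD⟩ := exists_density_condExp_eq_zero (μ := μ)
      (ℱ.mono (Fin.castSucc_lt_succ (i := t₀)).le) (ℱ.le t₀.succ)
      ((hint t₀.succ).sub (hint t₀.castSucc))
      ((hA t₀.succ).sub ((hA t₀.castSucc).mono (ℱ.mono Fin.castSucc_lt_succ.le) le_rfl))
      -- No arbitrage depends only on null sets, so it passes from `P` to the equivalent `μ`.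
      fun H hH h0 => hμP.ae_le (hNA t₀ H hH (hPμ.ae_le h0))
    have hZ : Measurable Z := hZm.mono (ℱ.le _) le_rfl
    refine ⟨μ.withDensity fun ω => ENNReal.ofReal (Z ω),
      isFiniteMeasure_withDensity_ofReal_of_le_one fun ω => (hZ0 ω).2,
      (withDensity_absolutelyContinuous _ _).trans hμP,
      hPμ.trans (absolutelyContinuous_withDensity_ofReal hZ fun ω => (hZ0 ω).1),
      fun s => integrable_withDensity_ofReal_of_bounded hZ hZ0 (hint s), fun t ht S hS => ?_⟩
    rw [setIntegral_withDensity_eq_setIntegral_toReal_smul hZ.ennreal_ofReal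
      (ae_of_all _ fun _ => ENNReal.ofReal_lt_top) _ (ℱ.le _ _ hS)]
    simp only [ENNReal.toReal_ofReal (hZ0 _).1.le, smul_eq_mul]
    rcases eq_or_ne t t₀ with rfl | hne
    · exact hZD S hS
    · have hlt : t₀ < t := by
        have : (t : ℕ) ≠ T - (k + 1) := fun h => hne (Fin.ext h)
        exact Fin.lt_def.2 (show T - (k + 1) < t by omega)
      refine setIntegral_mul_eq_zero_of_measurable (ℱ.le t.castSucc)
        ((hint t.succ).sub (hint t.castSucc))
        (hZm.mono (ℱ.mono (Fin.succ_le_castSucc_iff.2 hlt)) le_rfl) (fun ω => ?_)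
        (hmart t (by have := Fin.lt_def.1 hlt; simp only [t₀] at this; omega)) hS
      rw [Real.norm_of_nonneg (hZ0 ω).1.le]
      exact (hZ0 ω).2

theorem martingale_of_setIntegral_increment_eq_zero {T : ℕ} {Q : Measure Ω} [IsFiniteMeasure Q]
    {ℱ : Filtration (Fin (T + 1)) mΩ} {A : Fin (T + 1) → Ω → ℝ}
    (hA : ∀ t, Measurable[ℱ t] (A t)) (hint : ∀ t, Integrable (A t) Q)
    (h : ∀ t : Fin T, ∀ S, MeasurableSet[ℱ t.castSucc] S →
        ∫ ω in S, (A t.succ ω - A t.castSucc ω) ∂Q = 0) : Martingale A ℱ Q := by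
  refine ⟨fun t => (hA t).stronglyMeasurable, fun s t hst => ?_⟩
  refine (ae_eq_condExp_of_forall_setIntegral_eq (ℱ.le s) (hint t)
    (fun _ _ _ => (hint s).integrableOn) (fun S hS _ => ?_)
    (hA s).stronglyMeasurable.aestronglyMeasurable).symm
  induction t using Fin.induction with
  | zero => rw [Fin.le_zero_iff.1 hst]
  | succ t ih =>
    rcases hst.eq_or_lt with rfl | hlt
    · rfl
    · have hle : s ≤ t.castSucc := Fin.le_castSucc_iff.2 hlt
      have := h t S (ℱ.mono hle _ hS)
      rw [integral_sub (hint _).integrableOn (hint _).integrableOn, sub_eq_zero] at this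
      rw [ih hle, this]

/-- The Dalang–Morton–Willinger theorem for a single asset. -/
theorem exists_equivalent_martingale_measure {T : ℕ} {P : Measure Ω} [IsProbabilityMeasure P]
    {ℱ : Filtration (Fin (T + 1)) mΩ} {A : Fin (T + 1) → Ω → ℝ}
    (hA : ∀ t, Measurable[ℱ t] (A t))
    (hNA : ∀ (t : Fin T) (H : Ω → ℝ), Measurable[ℱ t.castSucc] H →
      (∀ᵐ ω ∂P, 0 ≤ H ω * (A t.succ ω - A t.castSucc ω)) →
      ∀ᵐ ω ∂P, H ω * (A t.succ ω - A t.castSucc ω) = 0) :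
    ∃ Q : Measure Ω, IsProbabilityMeasure Q ∧ Q ≪ P ∧ P ≪ Q ∧ Martingale A ℱ Q := by
  obtain ⟨μ, hμ, hμP, hPμ, hint, hmart⟩ := exists_finite_measure_increments hA hNA T
  have h0 : μ univ ≠ 0 := fun h => by simpa using hPμ h
  have : NeZero μ := ⟨fun h => h0 (by simp [h])⟩
  have hc : (μ univ)⁻¹ ≠ 0 := ENNReal.inv_ne_zero.2 (measure_ne_top μ univ)
  have hc' : (μ univ)⁻¹ ≠ ∞ := ENNReal.inv_ne_top.2 h0
  refine ⟨(μ univ)⁻¹ • μ, isProbabilityMeasureSMul, Measure.smul_absolutelyContinuous.trans hμP,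
    hPμ.trans (Measure.absolutelyContinuous_smul hc), ?_⟩
  have : IsProbabilityMeasure ((μ univ)⁻¹ • μ) := isProbabilityMeasureSMul
  refine martingale_of_setIntegral_increment_eq_zero hA (fun t => (hint t).smul_measure hc')
    fun t S hS => ?_
  rw [Measure.restrict_smul, integral_smul_measure, hmart t (by omega) S hS, smul_zero]

end EquivalentMartingaleMeasure

/-! ### Revenue and its measurability -/

namespace EmissionMarket

variable {Ω : Type*} [mΩ : MeasurableSpace Ω] {I : Type*} [Fintype I] {T : ℕ}
  {P : Measure Ω} {ℱ : Filtration (Fin (T + 1)) mΩ}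

/-- Shows that the penalty sees the trades only through their total, so a perturbation is evaluated
by computing two sums over all dates. -/
theorem revenue_eq (M : EmissionMarket I T P ℱ) (A : Fin (T + 1) → Ω → ℝ) (i : I)
    (ϑ : Fin (T + 1) → Ω → ℝ) (ξ : Fin T → Ω → ℝ) (ω : Ω) :
    M.revenue A i ϑ ξ ω = -(∑ s, ϑ s ω * A s ω) - ∑ t, M.C i t (ξ t ω) ω
      - M.penalty * max ((∑ t, (M.E i t ω - ξ t ω)) - M.γ i ω - ∑ s, ϑ s ω) 0 := by
  rw [revenue, Fin.sum_univ_castSucc (fun s => ϑ s ω * A s ω),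
    Fin.sum_univ_castSucc (fun s => ϑ s ω)]
  simp only [Finset.sum_add_distrib, Finset.sum_sub_distrib]
  have h : ∀ a b c d e : ℝ, a - b - c - d - e = a - b - d - (c + e) := fun _ _ _ _ _ => by ring
  rw [h]
  ring

/-- The cost is jointly measurable only on `[0, ∞)`, and feasible policies are nonnegative only
almost surely; hence the truncation. -/
theorem measurable_C_comp (M : EmissionMarket I T P ℱ) (i : I) (t : Fin T) {x : Ω → ℝ}
    (hx : Measurable[ℱ t.castSucc] x) :
    Measurable[ℱ t.castSucc] fun ω => M.C i t (max (x ω) 0) ω := by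
  have h1 : Measurable[ℱ t.castSucc] fun ω => (⟨max (x ω) 0, mem_Ici.2 (le_max_right _ _)⟩ : Ici (0 : ℝ)) :=
    @Measurable.subtype_mk _ _ (ℱ t.castSucc) _ _ _ (hx.max measurable_const) _
  have h2 := @Measurable.prodMk _ (ℱ t.castSucc) _ _ _ (ℱ t.castSucc) _ _ h1
    (@measurable_id _ (ℱ t.castSucc))
  exact (M.measurable_C i t).comp h2

theorem Feasible.aemeasurable_revenue {M : EmissionMarket I T P ℱ} {A : Fin (T + 1) → Ω → ℝ}
    {i : I} {ϑ : Fin (T + 1) → Ω → ℝ} {ξ : Fin T → Ω → ℝ} (h : M.Feasible i ϑ ξ)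
    (hA : ∀ t, Measurable[ℱ t] (A t)) : AEMeasurable (M.revenue A i ϑ ξ) P := by
  have hm : ∀ t, ∀ {f : Ω → ℝ}, Measurable[ℱ t] f → Measurable f := fun t f hf =>
    hf.mono (ℱ.le t) le_rfl
  have hA' := fun t => hm t (hA t)
  have hϑ := fun t => hm t (h.1 t)
  have hξ := fun t => hm _ (h.2.1 t)
  have hE := fun t => hm _ (M.measurable_E i t)
  have hγ := hm _ (M.measurable_γ i)
  have hC : ∀ t, AEMeasurable (fun ω => M.C i t (ξ t ω) ω) P := fun t =>
    ⟨_, hm _ (M.measurable_C_comp i t (h.2.1 t)), (h.2.2 t).mono fun ω hω => by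
      simp only [max_eq_left hω.1]⟩
  rw [show M.revenue A i ϑ ξ = _ from funext fun ω => M.revenue_eq A i ϑ ξ ω]
  have hCs : AEMeasurable (fun ω => ∑ t, M.C i t (ξ t ω) ω) P :=
    Finset.aemeasurable_fun_sum _ fun t _ => hC t
  have h1 : Measurable fun ω => ∑ s, ϑ s ω * A s ω := by fun_prop
  have h2 : Measurable fun ω => M.penalty *
      max ((∑ t, (M.E i t ω - ξ t ω)) - M.γ i ω - ∑ s, ϑ s ω) 0 := by fun_prop
  exact (h1.neg.aemeasurable.sub hCs).sub h2.aemeasurable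

/-- Without agents the total allocation would be the constant `0`, an atom of mass one. -/
theorem nonempty_agents [IsProbabilityMeasure P] (M : EmissionMarket I T P ℱ) : Nonempty I := by
  by_contra hI
  rw [not_nonempty_iff] at hI
  have := M.no_point_mass (fun _ => 0) measurable_const
  simp at this

/-! ### Perturbations of an equilibrium policy -/

namespace IsEquilibrium

variable {M : EmissionMarket I T P ℱ} {A : Fin (T + 1) → Ω → ℝ}
  {ϑ : I → Fin (T + 1) → Ω → ℝ} {ξ : I → Fin T → Ω → ℝ}

/-- A feasible policy that almost surely yields at least the equilibrium revenue yields exactly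
the equilibrium revenue. -/
theorem revenue_ae_eq (h : M.IsEquilibrium A ϑ ξ) {i : I} {ϑ' : Fin (T + 1) → Ω → ℝ}
    {ξ' : Fin T → Ω → ℝ} (hf : M.Feasible i ϑ' ξ')
    (hle : ∀ᵐ ω ∂P, M.revenue A i (ϑ i) (ξ i) ω ≤ M.revenue A i ϑ' ξ' ω) :
    ∀ᵐ ω ∂P, M.revenue A i ϑ' ξ' ω = M.revenue A i (ϑ i) (ξ i) ω := by
  set L := M.revenue A i (ϑ i) (ξ i)
  set L' := M.revenue A i ϑ' ξ'
  have hL : AEMeasurable L P := (h.feasible i).aemeasurable_revenue h.adapted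
  have hL' : AEMeasurable L' P := hf.aemeasurable_revenue h.adapted
  have hU := (M.continuous_U i).measurable
  have hU' := (M.strictMono_U i).monotone
  have hpos : (fun ω => ENNReal.ofReal (M.U i (L ω))) ≤ᵐ[P]
      fun ω => ENNReal.ofReal (M.U i (L' ω)) :=
    hle.mono fun ω hω => ENNReal.ofReal_le_ofReal (hU' hω)
  have hneg : (fun ω => ENNReal.ofReal (-M.U i (L' ω))) ≤ᵐ[P]
      fun ω => ENNReal.ofReal (-M.U i (L ω)) :=
    hle.mono fun ω hω => ENNReal.ofReal_le_ofReal (neg_le_neg (hU' hω))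
  have hex : ∫⁻ ω, ENNReal.ofReal (-M.U i (L ω)) ∂P ≠ ∞ := h.utility_exists i
  have hex' : ∫⁻ ω, ENNReal.ofReal (-M.U i (L' ω)) ∂P ≠ ∞ :=
    ne_top_of_le_ne_top hex (lintegral_mono_ae hneg)
  have hopt := h.optimal i ϑ' ξ' hf hex'
  have htop := h.utility_ne_top i
  have hpos' := lintegral_mono_ae hpos
  have hneg' := lintegral_mono_ae hneg
  change ((∫⁻ ω, ENNReal.ofReal (M.U i (L' ω)) ∂P : ℝ≥0∞) : EReal) -
      ((∫⁻ ω, ENNReal.ofReal (-M.U i (L' ω)) ∂P : ℝ≥0∞) : EReal) ≤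
    ((∫⁻ ω, ENNReal.ofReal (M.U i (L ω)) ∂P : ℝ≥0∞) : EReal) -
      ((∫⁻ ω, ENNReal.ofReal (-M.U i (L ω)) ∂P : ℝ≥0∞) : EReal) at hopt
  change ((∫⁻ ω, ENNReal.ofReal (M.U i (L ω)) ∂P : ℝ≥0∞) : EReal) -
      ((∫⁻ ω, ENNReal.ofReal (-M.U i (L ω)) ∂P : ℝ≥0∞) : EReal) ≠ ⊤ at htop
  -- With positive parts `p ≤ p'` and negative parts `n' ≤ n`, the reverse inequality of finite
  -- differences leaves no slack in either part.
  have key : ∀ p n p' n' : ℝ≥0∞, n ≠ ∞ → n' ≠ ∞ → (p : EReal) - n ≠ ⊤ →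
      (p' : EReal) - n' ≤ p - n → p ≤ p' → n' ≤ n → p ≠ ∞ ∧ p' ≤ p ∧ n ≤ n' := by
    intro p n p' n' hn hn' ht ho hp hnn
    lift n to NNReal using hn
    lift n' to NNReal using hn'
    have e : ∀ r : NNReal, (((r : ℝ≥0∞)) : EReal) = ((r : ℝ) : EReal) := fun r => rfl
    have hpt : p ≠ ∞ := by
      rintro rfl
      exact ht (by rw [e]; simp)
    lift p to NNReal using hpt
    have hpt' : p' ≠ ∞ := by
      rintro rfl
      rw [e, e, e, EReal.coe_ennreal_top, EReal.top_sub_coe, top_le_iff] at ho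
      exact EReal.coe_ne_top _ ho
    lift p' to NNReal using hpt'
    simp only [e] at ho
    norm_cast at ho hp hnn ⊢
    have ho' : (p' : ℝ) - n' ≤ p - n := by exact_mod_cast ho
    have hp' : (p : ℝ) ≤ p' := hp
    have hn' : (n' : ℝ) ≤ n := hnn
    refine ⟨ENNReal.coe_ne_top, ?_, ?_⟩
    · exact NNReal.coe_le_coe.1 (by linarith)
    · exact NNReal.coe_le_coe.1 (by linarith)
  obtain ⟨hpt, hp1, hn1⟩ := key _ _ _ _ hex hex' htop hopt hpos' hneg'
  have e1 := ae_eq_of_ae_le_of_lintegral_le hpos hpt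
    (hU.comp_aemeasurable hL').ennreal_ofReal hp1
  have e2 := ae_eq_of_ae_le_of_lintegral_le hneg hex'
    (hU.comp_aemeasurable hL).neg.ennreal_ofReal hn1
  filter_upwards [e1, e2, hle] with ω h1 h2 h3
  refine (M.strictMono_U i).injective (le_antisymm ?_ (hU' h3))
  rcases le_or_gt (M.U i (L' ω)) 0 with h0 | h0
  · have h4 : 0 ≤ -M.U i (L' ω) := by linarith
    have := (ENNReal.ofReal_le_ofReal_iff h4).1 h2.ge
    linarith
  · by_contra! h5
    exact absurd h1 ((ENNReal.ofReal_lt_ofReal_iff h0).2 h5).ne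

/-- Absence of arbitrage over one period. -/
theorem no_arbitrage [IsProbabilityMeasure P] (h : M.IsEquilibrium A ϑ ξ) (t : Fin T) {H : Ω → ℝ}
    (hH : Measurable[ℱ t.castSucc] H)
    (hpos : ∀ᵐ ω ∂P, 0 ≤ H ω * (A t.succ ω - A t.castSucc ω)) :
    ∀ᵐ ω ∂P, H ω * (A t.succ ω - A t.castSucc ω) = 0 := by
  obtain ⟨i⟩ := M.nonempty_agents
  -- Buy `H` at `t`, resell at `t + 1`: the final position, and with it the penalty, is unchanged.
  set ϑ' : Fin (T + 1) → Ω → ℝ := fun s ω => ϑ i s ω +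
    ((if s = t.castSucc then H ω else 0) - if s = t.succ then H ω else 0)
  have hrev : ∀ ω, M.revenue A i ϑ' (ξ i) ω =
      M.revenue A i (ϑ i) (ξ i) ω + H ω * (A t.succ ω - A t.castSucc ω) := by
    intro ω
    have h1 : ∑ s, ϑ' s ω = ∑ s, ϑ i s ω := by
      simp [ϑ', Finset.sum_add_distrib, Finset.sum_sub_distrib]
    have h2 : ∑ s, ϑ' s ω * A s ω =
        ∑ s, ϑ i s ω * A s ω - H ω * (A t.succ ω - A t.castSucc ω) := by
      simp only [ϑ', add_mul, sub_mul, ite_mul, zero_mul, Finset.sum_add_distrib,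
        Finset.sum_sub_distrib, Finset.sum_ite_eq', Finset.mem_univ, if_true]
      ring
    rw [revenue_eq, revenue_eq, h1, h2]
    ring
  have hf : M.Feasible i ϑ' (ξ i) := by
    refine ⟨fun s => ((h.feasible i).1 s).add (.sub ?_ ?_), (h.feasible i).2⟩
    · split_ifs with hs
      · exact hs ▸ hH
      · exact measurable_const
    · split_ifs with hs
      · exact hH.mono (ℱ.mono (hs ▸ Fin.castSucc_lt_succ.le)) le_rfl
      · exact measurable_const
  have := h.revenue_ae_eq hf (hpos.mono fun ω hω => by rw [hrev]; linarith)
  filter_upwards [this] with ω hω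
  rw [hrev] at hω
  linarith

theorem abatement_le (h : M.IsEquilibrium A ϑ ξ) (i : I) (t : Fin T) (q : ℝ) :
    ∀ᵐ ω ∂P, q ∈ Icc 0 (M.E i t ω) →
      M.C i t (ξ i t ω) ω - A t.castSucc ω * ξ i t ω ≤ M.C i t q ω - A t.castSucc ω * q := by
  classical
  by_cases hq : 0 ≤ q
  swap
  · exact ae_of_all _ fun ω hω => absurd hω.1 hq
  have hξ := (h.feasible i).2.1 t
  have hA := h.adapted t.castSucc
  have hC : Measurable[ℱ t.castSucc] fun ω => M.C i t q ω := by
    simpa only [max_eq_left hq] using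
      M.measurable_C_comp i t (x := fun _ => q) measurable_const
  -- The event, known at `t`, on which `q` is feasible and strictly better than the equilibrium
  -- abatement.
  set S : Set Ω := {ω | q ≤ M.E i t ω} ∩ {ω | M.C i t q ω - A t.castSucc ω * q <
    M.C i t (max (ξ i t ω) 0) ω - A t.castSucc ω * ξ i t ω}
  have hS : MeasurableSet[ℱ t.castSucc] S := by
    refine MeasurableSet.inter (measurableSet_le measurable_const (M.measurable_E i t)) ?_
    exact measurableSet_lt (hC.sub (hA.mul measurable_const))
      ((M.measurable_C_comp i t hξ).sub (hA.mul hξ))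
  set x : Ω → ℝ := S.piecewise (fun _ => q) (ξ i t)
  have hx : Measurable[ℱ t.castSucc] x := Measurable.piecewise hS measurable_const hξ
  set ξ' : Fin T → Ω → ℝ := Function.update (ξ i) t x
  -- Abating `x` instead of `ξ i t` raises emissions by the difference, which is covered by buying
  -- that many allowances at `t`.
  set ϑ' : Fin (T + 1) → Ω → ℝ := fun s ω => ϑ i s ω +
    if s = t.castSucc then ξ i t ω - x ω else 0
  have hupd : ∀ (F : Fin T → ℝ → ℝ) ω,
      ∑ s, F s (ξ' s ω) = ∑ s, F s (ξ i s ω) + (F t (x ω) - F t (ξ i t ω)) := by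
    intro F ω
    rw [← sub_eq_iff_eq_add', ← Finset.sum_sub_distrib, Finset.sum_eq_single t]
    · simp [ξ']
    · intro s _ hs
      simp [ξ', Function.update_of_ne hs]
    · simp
  have hrev : ∀ ω, M.revenue A i ϑ' ξ' ω = M.revenue A i (ϑ i) (ξ i) ω +
      ((M.C i t (ξ i t ω) ω - A t.castSucc ω * ξ i t ω) -
        (M.C i t (x ω) ω - A t.castSucc ω * x ω)) := by
    intro ω
    have h1 : ∑ s, ϑ' s ω = ∑ s, ϑ i s ω + (ξ i t ω - x ω) := by
      simp [ϑ', Finset.sum_add_distrib]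
    have h2 : ∑ s, ϑ' s ω * A s ω =
        ∑ s, ϑ i s ω * A s ω + (ξ i t ω - x ω) * A t.castSucc ω := by
      simp only [ϑ', add_mul, ite_mul, zero_mul, Finset.sum_add_distrib,
        Finset.sum_ite_eq', Finset.mem_univ, if_true]
    have h3 := hupd (fun s y => M.E i s ω - y) ω
    have h4 := hupd (fun s y => M.C i s y ω) ω
    have h5 : ∀ a b c d e f : ℝ, a + (b - c - (b - d)) - e - (f + (d - c)) = a - e - f :=
      fun a b c d e f => by ring
    rw [revenue_eq, revenue_eq, h1, h2, h3, h4, h5]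
    ring
  have hf : M.Feasible i ϑ' ξ' := by
    refine ⟨fun s => ((h.feasible i).1 s).add ?_, fun s => ?_, fun s => ?_⟩
    · split_ifs with hs
      · exact hs ▸ hξ.sub hx
      · exact measurable_const
    · by_cases hs : s = t
      · subst hs
        simpa [ξ'] using hx
      · simpa [ξ', Function.update_of_ne hs] using (h.feasible i).2.1 s
    · by_cases hs : s = t
      · subst hs
        filter_upwards [(h.feasible i).2.2 s] with ω hω
        by_cases hωS : ω ∈ S
        · simpa [ξ', x, hωS, hq] using hωS.1
        · simpa [ξ', x, hωS] using hω
      · simpa [ξ', Function.update_of_ne hs] using (h.feasible i).2.2 s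
  have hfeas := (h.feasible i).2.2 t
  have heq := h.revenue_ae_eq hf <| hfeas.mono fun ω hω => by
    rw [hrev]
    by_cases hωS : ω ∈ S
    · have := hωS.2
      simp only [mem_ofPred_eq, max_eq_left hω.1] at this
      simp only [x, piecewise_eq_of_mem _ _ _ hωS]
      linarith
    · simp [x, hωS]
  filter_upwards [heq, hfeas] with ω hω h0 hqE
  by_contra! hlt
  have hωS : ω ∈ S := ⟨hqE.2, by simpa only [mem_ofPred_eq, max_eq_left h0.1] using hlt⟩
  rw [hrev] at hω
  simp only [x, piecewise_eq_of_mem _ _ _ hωS] at hω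
  linarith

/-- Testing against rational volumes only keeps the exceptional null sets countable in number;
continuity of the cost extends the inequality to the whole interval, and the minimiser is unique. -/
theorem abatement_eq (h : M.IsEquilibrium A ϑ ξ) (i : I) (t : Fin T) :
    ∀ᵐ ω ∂P, ξ i t ω = M.abatementVolume i t (A t.castSucc ω) ω := by
  have hq : ∀ᵐ ω ∂P, ∀ q : ℚ, (q : ℝ) ∈ Icc 0 (M.E i t ω) →
      M.C i t (ξ i t ω) ω - A t.castSucc ω * ξ i t ω ≤
        M.C i t q ω - A t.castSucc ω * q :=
    ae_all_iff.2 fun q => h.abatement_le i t q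
  filter_upwards [hq, (h.feasible i).2.2 t] with ω hω h0
  refine (M.existsUnique_minimiser i t (A t.castSucc ω) ω).unique ⟨h0, fun y hy => ?_⟩
    (M.abatementVolume_spec i t _ ω)
  -- The density of the rationals in the interval is invoked only for a nondegenerate one; an
  -- interval reduced to a point is trivial.
  rcases (h0.1.trans h0.2).eq_or_lt with hE | hE
  · have h1 : ξ i t ω = y := by
      have := hy.1
      have := hy.2
      linarith
    rw [mem_ofPred_eq, h1]
  have hcont : ContinuousOn (fun x => M.C i t x ω - A t.castSucc ω * x) (Icc 0 (M.E i t ω)) :=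
    ((M.continuousOn_C i t ω).mono fun x hx => hx.1).sub (by fun_prop)
  have hy' : y ∈ closure (Icc 0 (M.E i t ω) ∩ range ((↑) : ℚ → ℝ)) := by
    rw [closure_ordConnected_inter_rat ordConnected_Icc ⟨0, left_mem_Icc.2 hE.le, _, right_mem_Icc.2 hE.le, hE.ne⟩]
    exact subset_closure hy
  refine ContinuousWithinAt.closure_le hy' continuousWithinAt_const
    ((hcont y hy).mono inter_subset_left) ?_
  rintro _ ⟨hq, q, rfl⟩
  exact hω q hq

/-- At time `T` there is no event on which a change `d` of the position lowers the sum of the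
trading cost and the penalty. -/
theorem terminal_trade [IsProbabilityMeasure P] (h : M.IsEquilibrium A ϑ ξ) (i : I) {d : Ω → ℝ}
    (hd : Measurable[ℱ (Fin.last T)] d) {S : Set Ω} (hS : MeasurableSet[ℱ (Fin.last T)] S)
    {G : Ω → ℝ}
    (hG : ∀ ω, G ω = ∑ t, (M.E i t ω - ξ i t ω) - M.γ i ω - ∑ s, ϑ i s ω)
    (hlt : ∀ ω ∈ S, M.penalty * max (G ω - d ω) 0 + d ω * A (Fin.last T) ω <
      M.penalty * max (G ω) 0) :
    ∀ᵐ ω ∂P, ω ∉ S := by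
  set ϑ' : Fin (T + 1) → Ω → ℝ := fun s ω => ϑ i s ω +
    if s = Fin.last T then S.indicator d ω else 0
  have hrev : ∀ ω, M.revenue A i ϑ' (ξ i) ω = M.revenue A i (ϑ i) (ξ i) ω +
      (M.penalty * max (G ω) 0 - (M.penalty * max (G ω - S.indicator d ω) 0 +
        S.indicator d ω * A (Fin.last T) ω)) := by
    intro ω
    have h1 : ∑ s, ϑ' s ω = ∑ s, ϑ i s ω + S.indicator d ω := by
      simp [ϑ', Finset.sum_add_distrib]
    have h2 : ∑ s, ϑ' s ω * A s ω =
        ∑ s, ϑ i s ω * A s ω + S.indicator d ω * A (Fin.last T) ω := by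
      simp only [ϑ', add_mul, ite_mul, zero_mul, Finset.sum_add_distrib,
        Finset.sum_ite_eq', Finset.mem_univ, if_true]
    rw [revenue_eq, revenue_eq, h1, h2, hG, ← sub_sub]
    ring
  have hf : M.Feasible i ϑ' (ξ i) := by
    refine ⟨fun s => ((h.feasible i).1 s).add ?_, (h.feasible i).2⟩
    split_ifs with hs
    · exact hs ▸ hd.indicator hS
    · exact measurable_const
  filter_upwards [h.revenue_ae_eq hf (ae_of_all _ fun ω => by
    rw [hrev]
    by_cases hω : ω ∈ S
    · simp only [indicator_of_mem hω]
      linarith [hlt ω hω]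
    · simp [hω])] with ω hω hωS
  rw [hrev] at hω
  simp only [indicator_of_mem hωS] at hω
  linarith [hlt ω hωS]

theorem terminal_price [IsProbabilityMeasure P] (h : M.IsEquilibrium A ϑ ξ) :
    ∀ᵐ ω ∂P, A (Fin.last T) ω =
      {ω' : Ω | 0 ≤ ∑ i, (∑ t : Fin T, (M.E i t ω' - ξ i t ω') - M.γ i ω')}.indicator
        (fun _ => M.penalty) ω := by
  have hπ := M.penalty_pos
  have hA := h.adapted (Fin.last T)
  have hlast : ∀ s, ∀ {f : Ω → ℝ}, Measurable[ℱ s] f → Measurable[ℱ (Fin.last T)] f :=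
    fun s f hf => hf.mono (ℱ.mono (Fin.le_last s)) le_rfl
  -- The shortage of agent `i` after all trades; negative values are a surplus.
  set G : I → Ω → ℝ := fun i ω => ∑ t, (M.E i t ω - ξ i t ω) - M.γ i ω - ∑ s, ϑ i s ω
  have hGm : ∀ i, Measurable[ℱ (Fin.last T)] (G i) := by
    intro i
    refine ((Finset.measurable_fun_sum _ fun t _ => ?_).sub (M.measurable_γ i)).sub
      (Finset.measurable_fun_sum _ fun s _ => hlast s ((h.feasible i).1 s))
    exact (hlast _ (M.measurable_E i t)).sub (hlast _ ((h.feasible i).2.1 t))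
  obtain ⟨i₀⟩ := M.nonempty_agents
  -- At a negative price, buying one more allowance pays and cannot raise the penalty.
  have hnonneg : ∀ᵐ ω ∂P, ω ∉ {ω | A (Fin.last T) ω < 0} := by
    refine h.terminal_trade i₀ (d := fun _ => 1) measurable_const
      (measurableSet_lt hA measurable_const) (fun ω => rfl) fun ω hω => ?_
    have : max (G i₀ ω - 1) 0 ≤ max (G i₀ ω) 0 := max_le_max (by linarith) le_rfl
    have := mul_le_mul_of_nonneg_left this hπ.le
    have := mem_ofPred_eq ▸ hω
    linarith
  -- Selling one allowance raises the penalty payment by at most `π`, so a price above `π` would be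
  -- a gain.
  have hle : ∀ᵐ ω ∂P, ω ∉ {ω | M.penalty < A (Fin.last T) ω} := by
    refine h.terminal_trade i₀ (d := fun _ => -1) measurable_const
      (measurableSet_lt measurable_const hA) (fun ω => rfl) fun ω hω => ?_
    have : max (G i₀ ω - -1) 0 ≤ max (G i₀ ω) 0 + 1 :=
      max_le (by linarith [le_max_left (G i₀ ω) 0]) (by linarith [le_max_right (G i₀ ω) 0])
    have := mul_le_mul_of_nonneg_left this hπ.le
    have := mem_ofPred_eq ▸ hω
    linarith
  -- The trade `d = G i` closes the position exactly: here it sells a worthless surplus at a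
  -- positive price, and in `hlong` it buys the shortage for less than the penalty.
  have hshort : ∀ᵐ ω ∂P, ∀ i, ω ∉ {ω | 0 < A (Fin.last T) ω} ∩ {ω | G i ω < 0} := by
    refine ae_all_iff.2 fun i => h.terminal_trade i (hGm i)
      ((measurableSet_lt measurable_const hA).inter (measurableSet_lt (hGm i) measurable_const))
      (fun ω => rfl) fun ω hω => ?_
    rw [sub_self, max_self, mul_zero, zero_add, max_eq_right (le_of_lt hω.2), mul_zero]
    exact mul_neg_of_neg_of_pos hω.2 hω.1
  have hlong : ∀ᵐ ω ∂P, ∀ i, ω ∉ {ω | A (Fin.last T) ω < M.penalty} ∩ {ω | 0 < G i ω} := by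
    refine ae_all_iff.2 fun i => h.terminal_trade i (hGm i)
      ((measurableSet_lt hA measurable_const).inter (measurableSet_lt measurable_const (hGm i)))
      (fun ω => rfl) fun ω hω => ?_
    rw [sub_self, max_self, mul_zero, zero_add, max_eq_left (le_of_lt hω.2), mul_comm]
    exact mul_lt_mul_of_pos_right hω.1 hω.2
  -- All emissions and abatements are known by `T - 1`, so the total allocation almost surely
  -- differs from total net emissions.
  have hmass : ∀ᵐ ω ∂P, ∑ i, (∑ t : Fin T, (M.E i t ω - ξ i t ω) - M.γ i ω) ≠ 0 := by
    have hT := M.horizon_pos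
    have hm : ∀ (t : Fin T) {f : Ω → ℝ}, Measurable[ℱ t.castSucc] f →
        Measurable[ℱ ⟨T - 1, by omega⟩] f := fun t f hf =>
      hf.mono (ℱ.mono (Fin.mk_le_mk.2 (by have := t.2; omega))) le_rfl
    have := M.no_point_mass (fun ω => ∑ i, ∑ t, (M.E i t ω - ξ i t ω))
      (Finset.measurable_fun_sum _ fun i _ => Finset.measurable_fun_sum _ fun t _ =>
        (hm t (M.measurable_E i t)).sub (hm t ((h.feasible i).2.1 t)))
    filter_upwards [measure_eq_zero_iff_ae_notMem.1 this] with ω hω h0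
    rw [Finset.sum_sub_distrib, sub_eq_zero] at h0
    exact hω h0.symm
  filter_upwards [hnonneg, hle, hshort, hlong, hmass, ae_all_iff.2 h.zero_net_supply]
    with ω h0 h1 h2 h3 h4 h5
  simp only [mem_inter_iff, mem_ofPred_eq, not_and, not_lt] at h0 h1 h2 h3
  -- Zero net supply cancels the trades in the aggregate shortage.
  have hsum : ∑ i, G i ω = ∑ i, (∑ t : Fin T, (M.E i t ω - ξ i t ω) - M.γ i ω) := by
    simp only [G]
    rw [Finset.sum_sub_distrib, Finset.sum_comm (s := Finset.univ) (t := Finset.univ)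
      (f := fun i s => ϑ i s ω)]
    simp [h5]
  rw [← hsum] at h4
  by_cases hS : 0 ≤ ∑ i, G i ω
  · rw [indicator_of_mem (by rwa [mem_ofPred_eq, ← hsum])]
    by_contra hne
    have := Finset.sum_nonpos fun i (_ : i ∈ Finset.univ) => h3 i (lt_of_le_of_ne h1 hne)
    exact h4 (le_antisymm this hS)
  · rw [indicator_of_notMem (by rwa [mem_ofPred_eq, ← hsum])]
    by_contra hne
    exact hS (Finset.sum_nonneg fun i _ => h2 i (lt_of_le_of_ne h0 (Ne.symm hne)))

end IsEquilibrium

end EmissionMarket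

theorem proposition1 {Ω : Type*} [mΩ : MeasurableSpace Ω] {I : Type*} [Fintype I] {T : ℕ}
    (P : Measure Ω) [IsProbabilityMeasure P] (ℱ : Filtration (Fin (T + 1)) mΩ)
    (M : EmissionMarket I T P ℱ) (A : Fin (T + 1) → Ω → ℝ) (ξ : I → Fin T → Ω → ℝ)
    (hA : M.IsEquilibriumPrice A ξ) :
    (∃ Q : Measure Ω, IsProbabilityMeasure Q ∧ Q ≪ P ∧ P ≪ Q ∧ Martingale A ℱ Q) ∧
    (∀ (i : I) (t : Fin T),
      ∀ᵐ ω ∂P, ξ i t ω = M.abatementVolume i t (A t.castSucc ω) ω) ∧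
    (∀ᵐ ω ∂P, A (Fin.last T) ω =
      {ω' : Ω | 0 ≤ ∑ i, (∑ t : Fin T, (M.E i t ω' - ξ i t ω') - M.γ i ω')}.indicator
        (fun _ => M.penalty) ω) := by
  obtain ⟨ϑ, h⟩ := hA
  exact ⟨exists_equivalent_martingale_measure h.adapted fun t _ => h.no_arbitrage t,
    h.abatement_eq, h.terminal_price⟩
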